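/- Call a compact connected metric space of topological dimension $1$ a curve. For a compact metric space $(X,d)$ let $C(X,X)$ be the space of continuous maps $X\to X$ with the topology of uniform convergence. For $f\in C(X,X)$ and $\varepsilon>0$, an $\varepsilon$-chain for $f$ from $x$ to $y$ is a finite sequence $x=x_0,x_1,\dots,x_n=y$ in $X$ with $n\ge 1$ such that $d(f(x_{i-1}),x_i)<\varepsilon$ for $i=1,\dots,n$. Let $CR(f)$ be the set of chain recurrent points of $f$, that is, of the points $x\in X$ such that for every $\varepsilon>0$ there is an $\varepsilon$-chain for $f$ from $x$ to $x$. Let 0-$CR$ be the class of all compact metric spaces $X$ such that $\{f\in C(X,X): \dim CR(f)=0\}$ is a dense $G_\delta$-subset of $C(X,X)$. Theorem. Every locally connected curve belongs to the class 0-$CR$. -/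

import Mathlib

/-- `c 0, …, c n` (with `n ≥ 1`) is an `ε`-chain for `f` from `x` to `y`: it starts at `x`, ends
at `y`, and `d (f (c i), c (i + 1)) < ε` for all `i < n`. Only the values `c 0, …, c n` matter.
A chain has at least one step (otherwise every point would be chain recurrent). -/
def IsEpsChain {X : Type*} [MetricSpace X] (f : X → X) (ε : ℝ) (x y : X) (n : ℕ) (c : ℕ → X) :
    Prop :=
  1 ≤ n ∧ c 0 = x ∧ c n = y ∧ ∀ i < n, dist (f (c i)) (c (i + 1)) < ε

/-- The set `CR(f)` of chain recurrent points of `f`: for each `ε > 0` there is an `ε`-chain for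
`f` from `x` to `x`. -/
def chainRecurrentSet {X : Type*} [MetricSpace X] (f : X → X) : Set X :=
  {x | ∀ ε > 0, ∃ (n : ℕ) (c : ℕ → X), IsEpsChain f ε x x n c}

/-- The class 0-CR: compact metric spaces `X` for which the maps `f : X → X` with zero-dimensional
set `CR(f)` form a dense `G_δ` subset of `C(X, X)`. For compact `X` the topology of `C(X, X)`
is that of uniform convergence. Dimension zero means nonempty with a basis of clopen sets. -/
def ZeroCR (X : Type*) [MetricSpace X] : Prop :=
  CompactSpace X ∧
    IsGδ {f : C(X, X) | smallInductiveDimension (chainRecurrentSet f) = 0} ∧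
    Dense {f : C(X, X) | smallInductiveDimension (chainRecurrentSet f) = 0}

/-- A curve is a one-dimensional continuum, i.e. a compact connected metric space of dimension one.
(For separable metric spaces the small inductive, large inductive and covering dimensions agree.) -/
def IsCurve (X : Type*) [MetricSpace X] : Prop :=
  CompactSpace X ∧ ConnectedSpace X ∧ smallInductiveDimension X = 1

open Set Filter Topology Metric Relation

/-!
Fix `δ > 0` and a map `f`. As `dim X ≤ 1`, a closed zero-dimensional set `Z` with empty interior
cuts `X` into finitely many small open pieces, so `f` is close to a map `b` which is constant on
each piece and takes its values off `Z`. A small closed neighbourhood `N` of `Z`, disjoint from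
these values, falls apart into small open pieces as well, hence `f` is close on `N` to a map `a`
which is constant on each of them. Compact locally connected spaces are uniformly locally path
connected, so that `a` and `b` can be joined over `N` by short paths, depending only on the
endpoints; this yields a continuous map `g` close to `f` that agrees with `b` off `N`. A
sufficiently fine chain for `g` that is once outside `N` steps close to the finite set `range b`
ever after, so `CR(g)` is contained in `N ∪ range b` and therefore splits at scale `δ`.

By upper semicontinuity of `CR`, the maps whose chain recurrent set splits at scale `δ` form an open
set. The maps `f` with `dim CR(f) = 0` are those for which this holds at every scale `1 / (n + 1)`,
and Baire's theorem applies.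
-/

section PolygonalPath

variable {X E : Type*} [PseudoMetricSpace X] [NormedAddCommGroup E] [NormedSpace ℝ E] {ι : X → E}

/-- A path in `E` is `δ`-polygonal along `ι : X → E` if it is a concatenation of straight segments,
each joining the images of two points of `X` at distance less than `δ`. Such paths replace
`δ`-chains in `X` by continuous maps, so that limits of finer and finer chains are continuous. -/
inductive IsPolygonalPath (ι : X → E) (δ : ℝ) : ∀ {x y : X}, Path (ι x) (ι y) → Prop
  | segment {x y : X} (h : dist x y < δ) : IsPolygonalPath ι δ (.segment (ι x) (ι y))
  | trans {x y z : X} {γ : Path (ι x) (ι y)} {γ' : Path (ι y) (ι z)}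
      (hγ : IsPolygonalPath ι δ γ) (hγ' : IsPolygonalPath ι δ γ') :
      IsPolygonalPath ι δ (γ.trans γ')

theorem dist_path_trans_le {Y : Type*} [PseudoMetricSpace Y] {a b c : Y} {r : ℝ}
    {γ₁ γ₂ : Path a b} {γ₁' γ₂' : Path b c} (h : ∀ t, dist (γ₁ t) (γ₂ t) ≤ r)
    (h' : ∀ t, dist (γ₁' t) (γ₂' t) ≤ r) (t : unitInterval) :
    dist (γ₁.trans γ₁' t) (γ₂.trans γ₂' t) ≤ r := by
  rw [Path.trans_apply, Path.trans_apply]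
  split_ifs
  exacts [h _, h' _]

theorem range_segment_subset_ball (hι : Isometry ι) {x y : X} {r : ℝ} (hxy : dist x y < r) :
    range (Path.segment (ι x) (ι y)) ⊆ ball (ι x) r := by
  rw [Path.range_segment]
  refine (convex_ball _ _).segment_subset (mem_ball_self (dist_nonneg.trans_lt hxy)) ?_
  rwa [mem_ball, hι.dist_eq, dist_comm]

theorem IsPolygonalPath.range_subset_thickening (hι : Isometry ι) {δ : ℝ} {x y : X}
    {γ : Path (ι x) (ι y)} (hγ : IsPolygonalPath ι δ γ) :
    range γ ⊆ thickening δ (range ι) := by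
  induction hγ with
  | segment h =>
    exact (range_segment_subset_ball hι h).trans (ball_subset_thickening (mem_range_self _) δ)
  | trans _ _ ih ih' => rw [Path.trans_range]; exact union_subset ih ih'

theorem exists_isPolygonalPath_of_isPreconnected (ι : X → E) {δ : ℝ} (hδ : 0 < δ) {C : Set X}
    (hC : IsPreconnected C) {x y : X} (hx : x ∈ C) (hy : y ∈ C) :
    ∃ γ : Path (ι x) (ι y), IsPolygonalPath ι δ γ ∧ range γ ⊆ convexHull ℝ (ι '' C) := by
  have range_segment_subset {a b : X} (ha : a ∈ C) (hb : b ∈ C) :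
      range (Path.segment (ι a) (ι b)) ⊆ convexHull ℝ (ι '' C) := by
    rw [Path.range_segment]
    exact segment_subset_convexHull (mem_image_of_mem ι ha) (mem_image_of_mem ι hb)
  refine hC.induction₂' (fun a b => ∃ γ : Path (ι a) (ι b), IsPolygonalPath ι δ γ ∧
    range γ ⊆ convexHull ℝ (ι '' C)) (fun a ha => ?_) ?_ hx hy
  · filter_upwards [self_mem_nhdsWithin, mem_nhdsWithin_of_mem_nhds (ball_mem_nhds a hδ)]
      with b hb hba
    exact ⟨⟨_, .segment (dist_comm a b ▸ hba), range_segment_subset ha hb⟩,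
      ⟨_, .segment hba, range_segment_subset hb ha⟩⟩
  · rintro a b c - - - ⟨γ, hγ, hγC⟩ ⟨γ', hγ', hγC'⟩
    refine ⟨γ.trans γ', hγ.trans hγ', ?_⟩
    rw [Path.trans_range]
    exact union_subset hγC hγC'

theorem IsPolygonalPath.exists_refinement (hι : Isometry ι) {δ δ' r : ℝ} (hδ' : 0 < δ')
    (h : ∀ x y : X, dist x y < δ → ∃ C, IsPreconnected C ∧ x ∈ C ∧ y ∈ C ∧ C ⊆ ball x r)
    {x y : X} {γ : Path (ι x) (ι y)} (hγ : IsPolygonalPath ι δ γ) :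
    ∃ γ' : Path (ι x) (ι y), IsPolygonalPath ι δ' γ' ∧ ∀ t, dist (γ t) (γ' t) ≤ 2 * r := by
  induction hγ with
  | @segment x y hxy =>
    obtain ⟨C, hC, hx, hy, hCr⟩ := h x y hxy
    obtain ⟨γ', hγ', hγC⟩ := exists_isPolygonalPath_of_isPreconnected ι hδ' hC hx hy
    refine ⟨γ', hγ', fun t => ?_⟩
    have hull_subset : convexHull ℝ (ι '' C) ⊆ ball (ι x) r :=
      convexHull_min (image_subset_iff.2 fun z hz => by
        simpa only [mem_preimage, mem_ball, hι.dist_eq] using hCr hz) (convex_ball _ _)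
    have hγx : dist (Path.segment (ι x) (ι y) t) (ι x) < r :=
      range_segment_subset_ball hι (dist_comm x y ▸ hCr hy) (mem_range_self t)
    have hγx' : dist (γ' t) (ι x) < r := hull_subset (hγC (mem_range_self t))
    linarith [dist_triangle_right (Path.segment (ι x) (ι y) t) (γ' t) (ι x)]
  | trans _ _ ih ih' =>
    obtain ⟨γ₁, hγ₁, hd⟩ := ih
    obtain ⟨γ₂, hγ₂, hd'⟩ := ih'
    exact ⟨γ₁.trans γ₂, hγ₁.trans hγ₂, dist_path_trans_le hd hd'⟩

theorem exists_seq_isPolygonalPath (hι : Isometry ι) {δ r : ℕ → ℝ} (hδ : ∀ n, 0 < δ n)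
    (h : ∀ n (x y : X), dist x y < δ n →
      ∃ C, IsPreconnected C ∧ x ∈ C ∧ y ∈ C ∧ C ⊆ ball x (r n))
    {x y : X} (hxy : dist x y < δ 0) :
    ∃ γ : ℕ → Path (ι x) (ι y), γ 0 = .segment (ι x) (ι y) ∧
      (∀ n, IsPolygonalPath ι (δ n) (γ n)) ∧ ∀ n t, dist (γ n t) (γ (n + 1) t) ≤ 2 * r n := by
  choose refined hrefined using fun n (γ : {γ : Path (ι x) (ι y) // IsPolygonalPath ι (δ n) γ}) =>
    γ.2.exists_refinement hι (hδ (n + 1)) (h n)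
  let γ : ∀ n, {γ : Path (ι x) (ι y) // IsPolygonalPath ι (δ n) γ} := fun n =>
    n.rec ⟨_, .segment hxy⟩ fun n γ => ⟨refined n γ, (hrefined n γ).1⟩
  exact ⟨fun n => (γ n).1, rfl, fun n => (γ n).2, fun n => (hrefined n (γ n)).2⟩

theorem joinedIn_ball_of_isPolygonalPath_seq [CompleteSpace X] [CompleteSpace E]
    (hι : Isometry ι) {δ : ℕ → ℝ} {C r : ℝ} (hδ : Tendsto δ atTop (𝓝 0)) {x y : X}
    (hxy : dist x y < r) {γ : ℕ → Path (ι x) (ι y)} (hγ₀ : γ 0 = .segment (ι x) (ι y))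
    (hγ : ∀ n, IsPolygonalPath ι (δ n) (γ n))
    (hdist : ∀ n t, dist (γ n t) (γ (n + 1) t) ≤ C / 2 / 2 ^ n) :
    JoinedIn (ball x (r + C)) x y := by
  have hdist' (n : ℕ) : dist (γ n).toContinuousMap (γ (n + 1)).toContinuousMap ≤ C / 2 / 2 ^ n :=
    ContinuousMap.dist_le_iff_of_nonempty.2 (hdist n)
  obtain ⟨L, hL⟩ := cauchySeq_tendsto_of_complete (cauchySeq_of_le_geometric_two hdist')
  have hLt (t : unitInterval) : Tendsto (fun n => γ n t) atTop (𝓝 (L t)) :=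
    ((continuous_eval_const t).tendsto L).comp hL
  have hL_range (t : unitInterval) : L t ∈ range ι := by
    rw [← hι.isUniformInducing.isComplete_range.isClosed.closure_eq, Metric.mem_closure_iff]
    intro ε hε
    obtain ⟨n, hδn, hn⟩ := ((hδ.eventually_lt_const (half_pos hε)).and
      (Metric.tendsto_nhds.1 (hLt t) _ (half_pos hε))).exists
    obtain ⟨w, hw, hγw⟩ := mem_thickening_iff.1
      ((hγ n).range_subset_thickening hι (mem_range_self t))
    exact ⟨w, hw, by linarith [dist_triangle_left (L t) w (γ n t)]⟩
  have hL_ball (t : unitInterval) : dist (L t) (ι x) < r + C := by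
    have h₀ : dist (γ 0 t) (ι x) < r :=
      hγ₀ ▸ range_segment_subset_ball hι hxy (mem_range_self t)
    have hL₀ : dist (γ 0 t) (L t) ≤ C := by
      simpa using dist_le_of_le_geometric_two_of_tendsto (fun n => hdist n t) (hLt t) 0
    linarith [dist_triangle_left (L t) (ι x) (γ 0 t)]
  have mem_ball_of_eq {t : unitInterval} {z : X} (hz : ι z = L t) : z ∈ ball x (r + C) := by
    rw [mem_ball, ← hι.dist_eq, hz]
    exact hL_ball t
  have hL₀ : L 0 = ι x := tendsto_nhds_unique (hLt 0) (by simp)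
  have hL₁ : L 1 = ι y := tendsto_nhds_unique (hLt 1) (by simp)
  refine (hι.isUniformInducing.isInducing.joinedIn_image (mem_ball_of_eq hL₀.symm)
    (mem_ball_of_eq hL₁.symm)).1 ⟨⟨L, hL₀, hL₁⟩, fun t => ?_⟩
  obtain ⟨z, hz⟩ := hL_range t
  exact ⟨z, mem_ball_of_eq hz, hz⟩

end PolygonalPath

theorem exists_isPreconnected_subset_ball (X : Type*) [PseudoMetricSpace X] [CompactSpace X]
    [LocallyConnectedSpace X] {ε : ℝ} (hε : 0 < ε) :
    ∃ δ > 0, ∀ x y : X, dist x y < δ →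
      ∃ C, IsPreconnected C ∧ x ∈ C ∧ y ∈ C ∧ C ⊆ ball x ε := by
  let V (z : X) : Set X := connectedComponentIn (ball z (ε / 2)) z
  obtain ⟨δ, hδ, hV⟩ := lebesgue_number_lemma_of_metric (c := V) isCompact_univ
    (fun _ => isOpen_ball.connectedComponentIn)
    (fun z _ => mem_iUnion.2 ⟨z, mem_connectedComponentIn (mem_ball_self (half_pos hε))⟩)
  refine ⟨δ, hδ, fun x y hxy => ?_⟩
  obtain ⟨z, hz⟩ := hV x (mem_univ x)
  have hx : x ∈ V z := hz (mem_ball_self hδ)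
  refine ⟨V z, isPreconnected_connectedComponentIn, hx, hz (mem_ball'.2 hxy), fun w hw => ?_⟩
  have hwz : dist w z < ε / 2 := mem_ball.1 (connectedComponentIn_subset _ _ hw)
  have hxz : dist x z < ε / 2 := mem_ball.1 (connectedComponentIn_subset _ _ hx)
  rw [mem_ball]
  linarith [dist_triangle_right w x z]

theorem exists_forall_joinedIn_ball (X : Type*) [MetricSpace X] [CompactSpace X]
    [LocallyConnectedSpace X] {ε : ℝ} (hε : 0 < ε) :
    ∃ δ > 0, ∀ x y : X, dist x y < δ → JoinedIn (ball x ε) x y := by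
  choose ρ hρ hC using fun n : ℕ =>
    exists_isPreconnected_subset_ball X (show 0 < ε / 8 / 2 ^ n by positivity)
  let δ (n : ℕ) : ℝ := min (ρ n) (ε / 2 / 2 ^ n)
  have hδ (n : ℕ) : 0 < δ n := lt_min (hρ n) (by positivity)
  have hδ_lim : Tendsto δ atTop (𝓝 0) :=
    squeeze_zero (fun n => (hδ n).le) (fun n => min_le_right _ _)
      ((tendsto_pow_atTop_atTop_of_one_lt one_lt_two).const_div_atTop (ε / 2))
  refine ⟨δ 0, hδ 0, fun x y hxy => ?_⟩
  obtain ⟨γ, hγ₀, hγ, hdist⟩ := exists_seq_isPolygonalPath (kuratowskiEmbedding.isometry X) hδ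
    (fun n x y h => hC n x y (h.trans_le (min_le_left _ _))) hxy
  have hxy' : dist x y < ε / 2 := by simpa using hxy.trans_le (min_le_right _ _)
  rw [← add_halves ε]
  exact joinedIn_ball_of_isPolygonalPath_seq (kuratowskiEmbedding.isometry X) hδ_lim hxy' hγ₀ hγ
    fun n t => (hdist n t).trans_eq (by ring)

section SplitsAt

variable {X : Type*} [PseudoMetricSpace X] {F G K : Set X} {δ δ' : ℝ}

/-- `K` splits at scale `δ` if a neighbourhood of `K` is partitioned into open sets each of which
lies in a ball of radius `δ`. The partition is encoded by a map `ψ` whose fibres are the pieces and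
whose values are the centres of the balls. -/
def SplitsAt (K : Set X) (δ : ℝ) : Prop :=
  ∃ ψ : X → X, ∀ x ∈ K, dist (ψ x) x < δ ∧ ∀ᶠ y in 𝓝 x, ψ y = ψ x

theorem SplitsAt.mono (h : SplitsAt K δ) (hFK : F ⊆ K) (hδ : δ ≤ δ') : SplitsAt F δ' :=
  h.imp fun _ hψ x hx => ⟨(hψ x (hFK hx)).1.trans_le hδ, (hψ x (hFK hx)).2⟩

theorem SplitsAt.exists_isOpen (h : SplitsAt K δ) : ∃ U, IsOpen U ∧ K ⊆ U ∧ SplitsAt U δ := by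
  obtain ⟨ψ, hψ⟩ := h
  refine ⟨{x | dist (ψ x) x < δ ∧ ∀ᶠ y in 𝓝 x, ψ y = ψ x}, ?_, hψ, ψ, fun _ => id⟩
  refine isOpen_iff_eventually.2 fun x ⟨hx, hψx⟩ => ?_
  filter_upwards [hψx.eventually_nhds, (isOpen_ball (x := ψ x) (ε := δ)).mem_nhds (mem_ball'.2 hx)]
    with y hy hyδ
  rw [hy.self_of_nhds]
  exact ⟨mem_ball'.1 hyδ, hy⟩

theorem SplitsAt.union_of_separatedNhds (hFG : SeparatedNhds F G) (hF : SplitsAt F δ)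
    (hG : SplitsAt G δ) : SplitsAt (F ∪ G) δ := by
  classical
  obtain ⟨U, V, hU, hV, hFU, hGV, hUV⟩ := hFG
  obtain ⟨ψ, hψ⟩ := hF
  obtain ⟨φ, hφ⟩ := hG
  have eqOn_left : EqOn (U.piecewise ψ φ) ψ U := piecewise_eqOn U ψ φ
  have eqOn_right : EqOn (U.piecewise ψ φ) φ V :=
    (piecewise_eqOn_compl U ψ φ).mono hUV.subset_compl_left
  refine ⟨U.piecewise ψ φ, ?_⟩
  rintro x (hx | hx)
  · rw [eqOn_left (hFU hx)]
    refine ⟨(hψ x hx).1, ?_⟩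
    filter_upwards [(hψ x hx).2, hU.mem_nhds (hFU hx)] with y hy hyU
    rwa [eqOn_left hyU]
  · rw [eqOn_right (hGV hx)]
    refine ⟨(hφ x hx).1, ?_⟩
    filter_upwards [(hφ x hx).2, hV.mem_nhds (hGV hx)] with y hy hyV
    rwa [eqOn_right hyV]

theorem splitsAt_of_subset_ball {x : X} (hK : K ⊆ ball x δ) : SplitsAt K δ :=
  ⟨fun _ => x, fun _ hy => ⟨mem_ball'.1 (hK hy), .of_forall fun _ => rfl⟩⟩

theorem hasSmallInductiveDimensionLE_zero_of_splitsAt (h : ∀ δ > 0, SplitsAt K δ) :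
    HasSmallInductiveDimensionLE K 0 := by
  refine hasSmallInductiveDimensionLT_one_iff.2 <|
    TopologicalSpace.isTopologicalBasis_of_isOpen_of_nhds (fun _ hC => hC.isOpen)
      fun x V hx hV => ?_
  obtain ⟨ε, hε, hεV⟩ := Metric.isOpen_iff.1 hV x hx
  obtain ⟨ψ, hψ⟩ := h (ε / 2) (half_pos hε)
  have isLocallyConstant : IsLocallyConstant (K.domRestrict ψ) :=
    (IsLocallyConstant.iff_eventually_eq _).2 fun y =>
      continuous_subtype_val.continuousAt.eventually (hψ y y.2).2
  refine ⟨_, isLocallyConstant.isClopen_fiber (ψ x), rfl, fun y (hy : ψ y = ψ x) => hεV ?_⟩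
  have hyε : dist (ψ x) y < ε / 2 := hy ▸ (hψ y y.2).1
  have hxε : dist (ψ x) x < ε / 2 := (hψ x x.2).1
  rw [mem_ball, Subtype.dist_eq]
  linarith [dist_triangle_left (y : X) x (ψ x)]

end SplitsAt

section ZeroDimensional

variable {X : Type*} [MetricSpace X] {F G K : Set X} {δ : ℝ}

theorem splitsAt_of_finite (hK : K.Finite) (hδ : 0 < δ) : SplitsAt K δ := by
  induction K, hK using Set.Finite.induction_on with
  | empty => exact ⟨id, by simp⟩
  | @insert x K hx hK ih =>
    rw [insert_eq]
    refine .union_of_separatedNhds ?_ (splitsAt_of_subset_ball (x := x) (by simpa using hδ)) ih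
    exact normal_separation isClosed_singleton hK.isClosed (disjoint_singleton_left.2 hx)

theorem splitsAt_of_hasSmallInductiveDimensionLE_zero (hK : IsCompact K)
    (hdim : HasSmallInductiveDimensionLE K 0) (hδ : 0 < δ) : SplitsAt K δ := by
  have : CompactSpace K := isCompact_iff_compactSpace.1 hK
  suffices ∃ C : Set K, univ ⊆ C ∧ IsClopen C ∧ SplitsAt (Subtype.val '' C) δ by
    obtain ⟨C, hC, -, h⟩ := this
    rwa [univ_subset_iff.1 hC, Subtype.coe_image_univ] at h
  refine isCompact_univ.induction_on
    (p := fun s => ∃ C : Set K, s ⊆ C ∧ IsClopen C ∧ SplitsAt (Subtype.val '' C) δ)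
    ⟨∅, Subset.rfl, isClopen_empty, by simpa using splitsAt_of_finite finite_empty hδ⟩
    (fun s t hst ⟨C, hC, h⟩ => ⟨C, hst.trans hC, h⟩) ?_ fun x _ => ?_
  · rintro s t ⟨C, hsC, hC, hCδ⟩ ⟨D, htD, hD, hDδ⟩
    refine ⟨C ∪ D, union_subset_union hsC htD, hC.union hD, ?_⟩
    have isClosed_image {A : Set K} (hA : IsClopen A) : IsClosed (Subtype.val '' A) :=
      (hA.isClosed.isCompact.image continuous_subtype_val).isClosed
    rw [← union_sdiff_self, image_union]
    refine .union_of_separatedNhds ?_ hCδ (hDδ.mono (image_mono sdiff_subset) le_rfl)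
    exact normal_separation (isClosed_image hC) (isClosed_image (hD.diff hC))
      ((disjoint_image_iff Subtype.val_injective).2 disjoint_sdiff_right)
  · obtain ⟨C, hC, hxC, hCδ⟩ :=
      (hasSmallInductiveDimensionLT_one_iff.1 hdim).exists_subset_of_mem_open
        (mem_ball_self hδ) (isOpen_ball (x := x))
    exact ⟨C, mem_nhdsWithin_of_mem_nhds (hC.isOpen.mem_nhds hxC), C, Subset.rfl, hC,
      splitsAt_of_subset_ball (image_subset_iff.2 hCδ)⟩

theorem hasSmallInductiveDimensionLE_zero_iff_splitsAt (hK : IsCompact K) :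
    HasSmallInductiveDimensionLE K 0 ↔ ∀ δ > 0, SplitsAt K δ :=
  ⟨fun h _ => splitsAt_of_hasSmallInductiveDimensionLE_zero hK h,
    hasSmallInductiveDimensionLE_zero_of_splitsAt⟩

theorem smallInductiveDimension_eq_zero_iff_splitsAt (hK : IsCompact K) (hne : K.Nonempty) :
    smallInductiveDimension K = 0 ↔ ∀ δ > 0, SplitsAt K δ := by
  have : Nonempty K := hne.to_subtype
  rw [← hasSmallInductiveDimensionLE_zero_iff_splitsAt hK]
  refine ⟨fun h => smallInductiveDimension_le_iff.1 (by simp [h]), fun h => ?_⟩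
  exact_mod_cast smallInductiveDimension_eq 0 h (by simp)

theorem SplitsAt.union (hδ : 0 < δ) (hF : IsCompact F) (hFδ : SplitsAt F δ) (hG : IsClosed G)
    (hGδ : ∀ t > 0, SplitsAt G t) : SplitsAt (F ∪ G) δ := by
  obtain ⟨U, hU, hFU, hUδ⟩ := hFδ.exists_isOpen
  obtain ⟨r, hr, hrU⟩ := hF.exists_thickening_subset_open hU hFU
  obtain ⟨V, hV, hGV, φ, hφ⟩ := (hGδ (r / 2) (half_pos hr)).exists_isOpen
  -- The pieces of the splitting of `G` that meet `F` are small enough to lie in `U`: there we use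
  -- the splitting of `F`, and the splitting of `G` on the pieces that miss `F`.
  let A : Set X := {x ∈ V | ∃ y ∈ F ∩ V, φ y = φ x}
  have hA : IsOpen A := isOpen_iff_eventually.2 fun x ⟨hxV, y, hy, hyx⟩ => by
    filter_upwards [hV.mem_nhds hxV, (hφ x hxV).2] with z hzV hzx
    exact ⟨hzV, y, hy, hyx.trans hzx.symm⟩
  have hVA : IsOpen (V \ A) := isOpen_iff_eventually.2 fun x ⟨hxV, hxA⟩ => by
    filter_upwards [hV.mem_nhds hxV, (hφ x hxV).2] with z hzV hzx
    exact ⟨hzV, fun ⟨_, y, hy, hyz⟩ => hxA ⟨hxV, y, hy, hyz.trans hzx⟩⟩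
  have hAU : A ⊆ U := fun x ⟨hxV, y, ⟨hyF, hyV⟩, hyx⟩ => hrU <| mem_thickening_iff.2 ⟨y, hyF, by
    have hx : dist (φ x) x < r / 2 := (hφ x hxV).1
    have hy : dist (φ x) y < r / 2 := hyx ▸ (hφ y hyV).1
    linarith [dist_triangle_left x y (φ x)]⟩
  have hGA : IsClosed (G ∩ A) := by
    convert hG.sdiff hVA using 1
    grind
  have hsplit : F ∪ G = (F ∪ G ∩ A) ∪ G \ A := by grind
  have hdisj : Disjoint (F ∪ G ∩ A) (G \ A) := by
    rw [disjoint_left]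
    rintro x (hxF | hx) hxGA
    exacts [hxGA.2 ⟨hGV hxGA.1, x, ⟨hxF, hGV hxGA.1⟩, rfl⟩, hxGA.2 hx.2]
  rw [hsplit]
  refine .union_of_separatedNhds ?_ (hUδ.mono ?_ le_rfl) ?_
  · exact normal_separation (hF.isClosed.union hGA) (hG.sdiff hA) hdisj
  · exact union_subset hFU (inter_subset_right.trans hAU)
  · exact (hGδ δ hδ).mono sdiff_subset le_rfl

theorem hasSmallInductiveDimensionLE_zero_union (hF : IsCompact F) (hG : IsCompact G)
    (hFdim : HasSmallInductiveDimensionLE F 0) (hGdim : HasSmallInductiveDimensionLE G 0) :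
    HasSmallInductiveDimensionLE (F ∪ G : Set X) 0 := by
  rw [hasSmallInductiveDimensionLE_zero_iff_splitsAt] at *
  exacts [fun δ hδ => (hFdim δ hδ).union hδ hF hG.isClosed hGdim, hF, hG, hF.union hG]

end ZeroDimensional

section ChainRecurrent

variable {X : Type*} [MetricSpace X]

/-- A single step of an `ε`-chain for `f`: the `ε`-chains are encoded by the transitive closure of
this relation. -/
def EpsStep (f : X → X) (ε : ℝ) (a b : X) : Prop :=
  dist (f a) b < ε

theorem exists_isEpsChain_iff_transGen {f : X → X} {ε : ℝ} {x y : X} :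
    (∃ n c, IsEpsChain f ε x y n c) ↔ TransGen (EpsStep f ε) x y := by
  constructor
  · rintro ⟨n, c, hn, rfl, rfl, hc⟩
    exact (transGen_of_succ_of_lt (fun i j => EpsStep f ε (c i) (c j)) (fun i hi => hc i hi.2)
      hn).lift c fun _ _ => id
  · intro h
    induction h using TransGen.head_induction_on with
    | @single a ha => exact ⟨1, fun i => i.casesOn a fun _ => y, le_rfl, rfl, rfl, by simpa⟩
    | @head a b hab _ ih =>
      obtain ⟨n, c, -, rfl, hcn, hc⟩ := ih
      refine ⟨n + 1, fun i => i.casesOn a c, by simp, rfl, hcn, ?_⟩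
      rintro (_ | i) hi
      exacts [hab, hc i (by simpa using hi)]

theorem mem_chainRecurrentSet_iff {f : X → X} {x : X} :
    x ∈ chainRecurrentSet f ↔ ∀ ε > 0, TransGen (EpsStep f ε) x x :=
  forall₂_congr fun _ _ => exists_isEpsChain_iff_transGen

theorem reflTransGen_epsStep_iterate (f : X → X) {ε : ℝ} (hε : 0 < ε) (x : X) (n : ℕ) :
    ReflTransGen (EpsStep f ε) x (f^[n] x) := by
  induction n with
  | zero => exact .refl
  | succ n ih => exact ih.tail (by simpa [EpsStep, Function.iterate_succ_apply'] using hε)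

theorem chainRecurrentSet_nonempty [CompactSpace X] [Nonempty X] {f : X → X} (hf : Continuous f) :
    (chainRecurrentSet f).Nonempty := by
  obtain ⟨x⟩ := ‹Nonempty X›
  obtain ⟨y, -, hy⟩ := isCompact_univ.exists_mapClusterPt (f := atTop) (u := fun n => f^[n] x)
    (by simp)
  refine ⟨y, mem_chainRecurrentSet_iff.2 fun ε hε => ?_⟩
  have recurs (N : ℕ) : ∃ n ≥ N, dist (f^[n] x) y < ε ∧ dist (f (f^[n] x)) (f y) < ε :=
    frequently_atTop.1 (hy.frequently (inter_mem (ball_mem_nhds y hε)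
      (hf.continuousAt.preimage_mem_nhds (ball_mem_nhds (f y) hε)))) N
  obtain ⟨m, -, -, hm⟩ := recurs 0
  obtain ⟨_, hn, hmn, -⟩ := recurs (m + 2)
  obtain ⟨k, rfl⟩ := Nat.exists_eq_add_of_le hn
  have first : EpsStep f ε y (f (f^[m] x)) := by rwa [EpsStep, dist_comm]
  have last : EpsStep f ε (f^[k] (f (f^[m] x))) y := by
    rw [← Function.iterate_succ_apply' f m, ← Function.iterate_add_apply, EpsStep,
      ← Function.iterate_succ_apply' f]
    convert hmn using 4
    omega
  exact .head' first ((reflTransGen_epsStep_iterate f hε _ k).tail last)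

theorem transGen_epsStep_of_forall_dist_lt {f g φ : X → X} {ε : ℝ} (hφ : ∀ z, dist z (φ z) < ε)
    (hfg : ∀ z, dist (f (φ z)) (g z) < ε) {x y : X} (h : TransGen (EpsStep g ε) x y) :
    TransGen (EpsStep f (3 * ε)) (φ x) (φ y) :=
  h.lift φ fun a b (hab : dist (g a) b < ε) => show dist (f (φ a)) (φ b) < 3 * ε by
    linarith [dist_triangle4 (f (φ a)) (g a) b (φ b), hφ b, hfg a]

theorem eventually_notMem_chainRecurrentSet [CompactSpace X] {f : C(X, X)} {x : X}
    (hx : x ∉ chainRecurrentSet f) :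
    ∀ᶠ p : C(X, X) × X in 𝓝 (f, x), p.2 ∉ chainRecurrentSet p.1 := by
  classical
  simp only [mem_chainRecurrentSet_iff, not_forall] at hx
  obtain ⟨ε, hε, hx⟩ := hx
  obtain ⟨η, hη, rfl⟩ : ∃ η > 0, ε = 3 * (2 * η) := ⟨ε / 6, by positivity, by ring⟩
  have hf : ∀ᶠ y in 𝓝 x, dist (f y) (f x) < η :=
    f.continuous.continuousAt.eventually (ball_mem_nhds (f x) hη)
  filter_upwards [prod_mem_nhds (ball_mem_nhds f hη) (inter_mem (ball_mem_nhds x hη) hf)]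
  rintro ⟨g, y⟩ ⟨hgf, hyx, hfy⟩ hy
  have hfg (z : X) : dist (f z) (g z) < η :=
    (ContinuousMap.dist_apply_le_dist z).trans_lt (mem_ball'.1 hgf)
  -- Moving `y` to `x` turns a fine chain for `g` from `y` to `y` into a chain for `f`.
  let φ : X → X := Function.update id y x
  have hφ (z : X) : dist z (φ z) < η ∧ dist (f (φ z)) (f z) < η := by
    obtain rfl | hz := eq_or_ne z y
    · simpa [φ] using ⟨hyx, mem_ball'.1 hfy⟩
    · simpa [φ, hz] using hη
  have hφy : φ y = x := Function.update_self ..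
  have hchain := transGen_epsStep_of_forall_dist_lt (f := f) (g := g) (φ := φ) (ε := 2 * η)
    (fun z => by linarith [hφ z])
    (fun z => by linarith [dist_triangle (f (φ z)) (f z) (g z), hφ z, hfg z])
    (mem_chainRecurrentSet_iff.1 hy _ (by positivity))
  exact hx (hφy ▸ hchain)

theorem isClosed_chainRecurrentSet [CompactSpace X] (f : C(X, X)) :
    IsClosed (chainRecurrentSet f) := by
  refine isOpen_compl_iff.1 (isOpen_iff_eventually.2 fun x hx => ?_)
  exact (Continuous.prodMk_right f).continuousAt.eventually (eventually_notMem_chainRecurrentSet hx)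

theorem eventually_chainRecurrentSet_subset [CompactSpace X] {f : C(X, X)} {U : Set X}
    (hU : IsOpen U) (h : chainRecurrentSet f ⊆ U) :
    ∀ᶠ g : C(X, X) in 𝓝 f, chainRecurrentSet g ⊆ U := by
  have avoids : ∀ᶠ g : C(X, X) in 𝓝 f, ∀ x ∈ Uᶜ, x ∉ chainRecurrentSet g :=
    hU.isClosed_compl.isCompact.eventually_forall_of_forall_eventually
      fun x hx => eventually_notMem_chainRecurrentSet fun hxf => hx (h hxf)
  filter_upwards [avoids] with g hg x hx
  exact by_contra fun hxU => hg x hxU hx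

theorem isOpen_setOf_splitsAt_chainRecurrentSet [CompactSpace X] (δ : ℝ) :
    IsOpen {f : C(X, X) | SplitsAt (chainRecurrentSet f) δ} := by
  refine isOpen_iff_eventually.2 fun f hf => ?_
  obtain ⟨U, hU, hfU, hUδ⟩ := SplitsAt.exists_isOpen hf
  filter_upwards [eventually_chainRecurrentSet_subset hU hfU] with g hg
  exact hUδ.mono hg le_rfl

theorem zeroCR_of_dense_splitsAt [CompactSpace X] [Nonempty X]
    (h : ∀ δ > 0, Dense {f : C(X, X) | SplitsAt (chainRecurrentSet f) δ}) : ZeroCR X := by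
  have setOf_eq_iInter : {f : C(X, X) | smallInductiveDimension (chainRecurrentSet f) = 0} =
      ⋂ n : ℕ, {f : C(X, X) | SplitsAt (chainRecurrentSet f) (1 / (n + 1))} := by
    ext f
    simp only [mem_ofPred_eq, mem_iInter, smallInductiveDimension_eq_zero_iff_splitsAt
      (isClosed_chainRecurrentSet f).isCompact (chainRecurrentSet_nonempty f.continuous)]
    refine ⟨fun hf n => hf _ Nat.one_div_pos_of_nat, fun hf δ hδ => ?_⟩
    obtain ⟨n, hn⟩ := exists_nat_one_div_lt hδ
    exact (hf n).mono Subset.rfl hn.le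
  refine ⟨‹_›, ?_, ?_⟩ <;> rw [setOf_eq_iInter]
  · exact .iInter_of_isOpen fun n => isOpen_setOf_splitsAt_chainRecurrentSet _
  · exact dense_iInter_of_isOpen_nat (fun n => isOpen_setOf_splitsAt_chainRecurrentSet _)
      fun n => h _ Nat.one_div_pos_of_nat

theorem chainRecurrentSet_subset_union {g : X → X} {C W : Set X} (hC : IsCompact C)
    (hW : IsClosed W) (hCW : Disjoint C W) (hg : ∀ x ∉ W, g x ∈ C) :
    chainRecurrentSet g ⊆ W ∪ C := by
  intro x hx
  by_contra hxWC
  obtain ⟨hxW, hxC⟩ := not_or.1 hxWC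
  obtain ⟨η, hη, hηC⟩ := hC.exists_thickening_subset_open
    (hW.union isClosed_singleton).isOpen_compl (t := (W ∪ {x})ᶜ) (by
      rw [compl_union, subset_inter_iff]
      exact ⟨hCW.subset_compl_right, by simpa using hxC⟩)
  have notMem_of_epsStep {a b : X} (ha : g a ∈ C) (hab : EpsStep g η a b) : b ∉ W ∪ {x} :=
    hηC (mem_thickening_iff.2 ⟨_, ha, mem_ball'.1 hab⟩)
  obtain ⟨b, hxb, hbx⟩ := TransGen.tail'_iff.1 (mem_chainRecurrentSet_iff.1 hx η hη)
  have hgb : g b ∈ C := by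
    clear hbx
    induction hxb with
    | refl => exact hg x hxW
    | tail _ hab ih => exact hg _ fun hW => notMem_of_epsStep ih hab (.inl hW)
  exact notMem_of_epsStep hgb hbx (.inr rfl)

end ChainRecurrent

section Cut

variable {X : Type*} [MetricSpace X] {τ : ℝ}

/-- A cut of `U` at scale `τ`: the closed zero-dimensional set `Z` has empty interior and contains
the frontier of `U`, and `X` without `Z` is partitioned into finitely many open pieces, those that
lie in `U` being contained in balls of radius `τ`. The pieces are encoded as fibres of the map `σ`,
whose values are the centres of the balls. -/
structure IsCutAt (U : Set X) (τ : ℝ) (Z : Set X) (σ : X → X) : Prop where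
  isClosed : IsClosed Z
  interior_eq_empty : interior Z = ∅
  dim_le : HasSmallInductiveDimensionLE Z 0
  frontier_subset : frontier U ⊆ Z
  finite_range : (range σ).Finite
  eventually_eq : ∀ x ∉ Z, ∀ᶠ y in 𝓝 x, σ y = σ x
  dist_lt : ∀ x ∈ U, dist (σ x) x < τ

theorem isCutAt_frontier {B : Set X} {x : X} (hB : IsOpen B)
    (hdim : HasSmallInductiveDimensionLE (frontier B) 0) (hBx : B ⊆ ball x τ) :
    IsCutAt B τ (frontier B) fun _ => x where
  isClosed := isClosed_frontier
  interior_eq_empty := by rw [← frontier_compl, interior_frontier hB.isClosed_compl]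
  dim_le := hdim
  frontier_subset := Subset.rfl
  finite_range := finite_range_const
  eventually_eq _ _ := .of_forall fun _ => rfl
  dist_lt _ hy := mem_ball'.1 (hBx hy)

theorem isCutAt_empty (x : X) : IsCutAt ∅ τ ∅ fun _ => x := by
  simpa using isCutAt_frontier (B := ∅) (x := x) (τ := τ) isOpen_empty
    (hasSmallInductiveDimensionLE_zero_of_splitsAt fun _ hδ => splitsAt_of_finite (by simp) hδ)
    (empty_subset _)

theorem IsCutAt.union [CompactSpace X] {U₁ U₂ Z₁ Z₂ : Set X} {σ₁ σ₂ : X → X}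
    [DecidablePred (· ∈ U₁)] (h₁ : IsCutAt U₁ τ Z₁ σ₁) (h₂ : IsCutAt U₂ τ Z₂ σ₂) :
    IsCutAt (U₁ ∪ U₂) τ (Z₁ ∪ Z₂) (U₁.piecewise σ₁ σ₂) where
  isClosed := h₁.isClosed.union h₂.isClosed
  interior_eq_empty := by
    rw [interior_union_isClosed_of_interior_empty h₁.isClosed h₂.interior_eq_empty,
      h₁.interior_eq_empty]
  dim_le := hasSmallInductiveDimensionLE_zero_union h₁.isClosed.isCompact h₂.isClosed.isCompact
    h₁.dim_le h₂.dim_le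
  frontier_subset := (frontier_union_subset _ _).trans <| union_subset_union
    (inter_subset_left.trans h₁.frontier_subset) (inter_subset_right.trans h₂.frontier_subset)
  finite_range := by
    rw [range_piecewise]
    exact (h₁.finite_range.subset (image_subset_range _ _)).union
      (h₂.finite_range.subset (image_subset_range _ _))
  eventually_eq x hx := by
    obtain ⟨hx₁, hx₂⟩ := not_or.1 hx
    have hxU : x ∈ (frontier U₁)ᶜ := fun h => hx₁ (h₁.frontier_subset h)
    rw [compl_frontier_eq_union_interior] at hxU
    obtain hxU | hxU := hxU
    · filter_upwards [isOpen_interior.mem_nhds hxU, h₁.eventually_eq x hx₁] with y hyU hy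
      rw [piecewise_eq_of_mem _ _ _ (interior_subset hyU),
        piecewise_eq_of_mem _ _ _ (interior_subset hxU), hy]
    · filter_upwards [isOpen_interior.mem_nhds hxU, h₂.eventually_eq x hx₂] with y hyU hy
      rw [piecewise_eq_of_notMem _ _ _ (interior_subset hyU),
        piecewise_eq_of_notMem _ _ _ (interior_subset hxU), hy]
  dist_lt x hx := by
    by_cases hxU : x ∈ U₁
    · rw [piecewise_eq_of_mem _ _ _ hxU]
      exact h₁.dist_lt x hxU
    · rw [piecewise_eq_of_notMem _ _ _ hxU]
      exact h₂.dist_lt x (hx.resolve_left hxU)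

theorem exists_isCutAt_univ [CompactSpace X] [Nonempty X]
    (hdim : HasSmallInductiveDimensionLE X 1) (hτ : 0 < τ) :
    ∃ (Z : Set X) (σ : X → X), IsCutAt univ τ Z σ := by
  classical
  obtain ⟨S, hS, hfrontier⟩ : ∃ S : Set (Set X), TopologicalSpace.IsTopologicalBasis S ∧
      ∀ U ∈ S, HasSmallInductiveDimensionLE (frontier U) 0 := by
    cases hdim with
    | succ _ S hS h => exact ⟨S, hS, h⟩
  suffices ∃ (U : Set X), univ ⊆ U ∧ ∃ Z σ, IsCutAt U τ Z σ by
    obtain ⟨U, hU, h⟩ := this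
    rwa [univ_subset_iff.1 hU] at h
  refine isCompact_univ.induction_on (p := fun s => ∃ U : Set X, s ⊆ U ∧ ∃ Z σ, IsCutAt U τ Z σ)
    ⟨∅, Subset.rfl, _, _, isCutAt_empty (Classical.arbitrary X)⟩
    (fun s t hst ⟨U, hU, h⟩ => ⟨U, hst.trans hU, h⟩) ?_ fun x _ => ?_
  · rintro s t ⟨U₁, hs, _, _, h₁⟩ ⟨U₂, ht, _, _, h₂⟩
    exact ⟨U₁ ∪ U₂, union_subset_union hs ht, _, _, h₁.union h₂⟩
  · obtain ⟨B, hBS, hxB, hB⟩ := hS.exists_subset_of_mem_open (mem_ball_self hτ)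
      (isOpen_ball (x := x))
    exact ⟨B, mem_nhdsWithin_of_mem_nhds ((hS.isOpen hBS).mem_nhds hxB), B, Subset.rfl, _, _,
      isCutAt_frontier (hS.isOpen hBS) (hfrontier B hBS) hB⟩

theorem exists_dist_lt_locallyConstant_compl [CompactSpace X] [Nonempty X]
    (hdim : HasSmallInductiveDimensionLE X 1) {f : X → X} (hf : Continuous f) {d : ℝ}
    (hd : 0 < d) :
    ∃ (Z : Set X) (b : X → X), IsClosed Z ∧ HasSmallInductiveDimensionLE Z 0 ∧
      (range b).Finite ∧ Disjoint Z (range b) ∧ (∀ x ∉ Z, ∀ᶠ y in 𝓝 x, b y = b x) ∧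
      ∀ x, dist (b x) (f x) < d := by
  obtain ⟨τ, hτ, hfτ⟩ := Metric.uniformContinuous_iff.1
    (CompactSpace.uniformContinuous_of_continuous hf) (d / 2) (half_pos hd)
  obtain ⟨Z, σ, h⟩ := exists_isCutAt_univ hdim hτ
  choose c hcZ hc using fun p : X =>
    (interior_eq_empty_iff_dense_compl.1 h.interior_eq_empty).exists_dist_lt p (half_pos hd)
  refine ⟨Z, fun x => c (f (σ x)), h.isClosed, h.dim_le, ?_, ?_, fun x hx => ?_, fun x => ?_⟩
  · exact (h.finite_range.image (c ∘ f)).subset (range_subset_iff.2 fun x =>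
      mem_image_of_mem (c ∘ f) (mem_range_self x))
  · rw [disjoint_right]
    exact forall_mem_range.2 fun x => hcZ _
  · filter_upwards [h.eventually_eq x hx] with y hy
    rw [hy]
  · linarith [hc (f (σ x)), hfτ (h.dist_lt x (mem_univ x)),
      dist_triangle_left (c (f (σ x))) (f x) (f (σ x))]

end Cut

theorem exists_continuousMap_unitInterval_mem_ball {Y : Type*} [PseudoMetricSpace Y] {ε : ℝ}
    (hε : 0 < ε) (p q : Y) :
    ∃ γ : C(unitInterval, Y), γ 1 = q ∧ (∀ t, γ t ∈ ball q ε) ∧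
      (JoinedIn (ball q ε) p q → γ 0 = p) := by
  by_cases h : JoinedIn (ball q ε) p q
  · exact ⟨h.somePath, h.somePath.target, h.somePath_mem, fun _ => h.somePath.source⟩
  · exact ⟨.const _ q, rfl, fun _ => mem_ball_self hε, fun h' => absurd h' h⟩

theorem exists_continuousMap_eqOn_compl {X Y : Type*} [TopologicalSpace X] [NormalSpace X]
    [PseudoMetricSpace Y] {Z N : Set X} (hZ : IsClosed Z) (hN : IsClosed N) (hZN : Z ⊆ interior N)
    {a b : X → Y} (ha : ∀ x ∈ N, ∀ᶠ y in 𝓝 x, a y = a x)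
    (hb : ∀ x ∉ Z, ∀ᶠ y in 𝓝 x, b y = b x) (hb_fin : (range b).Finite) {ε : ℝ} (hε : 0 < ε)
    (hab : ∀ x ∈ N, JoinedIn (ball (b x) ε) (a x) (b x)) :
    ∃ g : C(X, Y), EqOn g b Nᶜ ∧ ∀ x, dist (g x) (b x) < ε := by
  obtain ⟨u, hu₀, hu₁, hu⟩ := exists_continuous_zero_one_of_isClosed hZ
    isOpen_interior.isClosed_compl (disjoint_compl_right_iff_subset.2 hZN)
  let v (x : X) : unitInterval := ⟨u x, hu x⟩
  have hv : Continuous v := by fun_prop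
  -- The paths depend only on their endpoints, hence are locally constant functions of `x` off `Z`.
  choose γ hγ₁ hγε hγ₀ using exists_continuousMap_unitInterval_mem_ball (Y := Y) hε
  let g (x : X) : Y := γ (a x) (b x) (v x)
  have hgN {x : X} (hx : x ∉ N) : g x = b x := by
    have hvx : v x = 1 := Subtype.ext (hu₁ fun h => hx (interior_subset h))
    simp only [g, hvx, hγ₁]
  have continuousAt_of_mem {x : X} (hx : x ∈ Z) : ContinuousAt g x := by
    have hxN : x ∈ N := interior_subset (hZN hx)
    have hvx : v x = 0 := Subtype.ext (hu₀ hx)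
    have hgx : g x = a x := by simp only [g, hvx, hγ₀ _ _ (hab x hxN)]
    rw [ContinuousAt, hgx]
    intro V hV
    rw [mem_map]
    have hγV : ∀ᶠ y in 𝓝 x, ∀ q ∈ range b, JoinedIn (ball q ε) (a x) q → γ (a x) q (v y) ∈ V :=
      (eventually_all_finite hb_fin).2 fun q _ => eventually_imp_distrib_left.2 fun h =>
        ((γ (a x) q).continuous.comp hv).continuousAt.eventually_mem
          (by simpa only [Function.comp_apply, hvx, hγ₀ _ _ h] using hV)
    filter_upwards [hγV, ha x hxN, isOpen_interior.mem_nhds (hZN hx)] with y hy hay hyN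
    have hyj := hab y (interior_subset hyN)
    simp only [mem_preimage, g, hay] at hyj ⊢
    exact hy _ (mem_range_self y) hyj
  have continuousAt_of_notMem {x : X} (hx : x ∉ Z) : ContinuousAt g x := by
    by_cases hxN : x ∈ N
    · refine ((γ (a x) (b x)).continuous.comp hv).continuousAt.congr ?_
      filter_upwards [ha x hxN, hb x hx] with y hay hby
      simp only [g, hay, hby, Function.comp_apply]
    · refine (continuousAt_const (y := b x)).congr ?_
      filter_upwards [hN.isOpen_compl.mem_nhds hxN, hb x hx] with y hyN hby
      rw [hgN hyN, hby]
  have hg : Continuous g := continuous_iff_continuousAt.2 fun x =>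
    (em (x ∈ Z)).elim continuousAt_of_mem continuousAt_of_notMem
  exact ⟨⟨g, hg⟩, fun x hx => hgN hx, fun x => hγε _ _ _⟩

section Density

variable {X : Type*} [MetricSpace X] [CompactSpace X] [Nonempty X] [LocallyConnectedSpace X]

theorem dense_setOf_splitsAt_chainRecurrentSet (hdim : HasSmallInductiveDimensionLE X 1) {δ : ℝ}
    (hδ : 0 < δ) : Dense {f : C(X, X) | SplitsAt (chainRecurrentSet f) δ} := by
  refine Metric.dense_iff.2 fun f ε hε => ?_
  obtain ⟨η, hη, hjoined⟩ := exists_forall_joinedIn_ball X (half_pos hε)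
  let d := min η (ε / 2)
  have hd : 0 < d := lt_min hη (half_pos hε)
  obtain ⟨Z, b, hZ, hZdim, hb_fin, hZb, hb, hbf⟩ :=
    exists_dist_lt_locallyConstant_compl hdim f.continuous (half_pos hd)
  obtain ⟨τ, hτ, hfτ⟩ := Metric.uniformContinuous_iff.1
    (CompactSpace.uniformContinuous_of_continuous f.continuous) (d / 2) (half_pos hd)
  obtain ⟨U, hU, hZU, hUsplit⟩ := (splitsAt_of_hasSmallInductiveDimensionLE_zero hZ.isCompact hZdim
    (lt_min hτ hδ)).exists_isOpen
  obtain ⟨V, hV, hZV, hVsub⟩ := normal_exists_closure_subset hZ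
    (hU.inter hb_fin.isClosed.isOpen_compl) (subset_inter hZU hZb.subset_compl_right)
  obtain ⟨hVU, hVb⟩ := subset_inter_iff.1 hVsub
  obtain ⟨ψ, hψ⟩ := hUsplit.mono hVU le_rfl
  have hψb (x : X) (hx : x ∈ closure V) : JoinedIn (ball (b x) (ε / 2)) (f (ψ x)) (b x) := by
    have hfψ : dist (f (ψ x)) (f x) < d / 2 := hfτ ((hψ x hx).1.trans_le (min_le_left _ _))
    have hdη : d ≤ η := min_le_left _ _
    refine (hjoined _ _ ?_).symm
    linarith [dist_triangle_right (b x) (f (ψ x)) (f x), hbf x]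
  obtain ⟨g, hgb, hgε⟩ := exists_continuousMap_eqOn_compl hZ isClosed_closure
    (hZV.trans (hV.subset_interior_iff.2 subset_closure))
    (fun x hx => (hψ x hx).2.mono fun _ => congrArg f) hb hb_fin (half_pos hε) hψb
  refine ⟨g, (ContinuousMap.dist_lt_iff hε).2 fun x => ?_, ?_⟩
  · linarith [dist_triangle (g x) (b x) (f x), hgε x, hbf x, min_le_right η (ε / 2)]
  · have hdisj : Disjoint (closure V) (range b) := disjoint_left.2 hVb
    have hCR : chainRecurrentSet g ⊆ closure V ∪ range b :=
      chainRecurrentSet_subset_union hb_fin.isCompact isClosed_closure hdisj.symm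
        fun x hx => ⟨x, (hgb hx).symm⟩
    have hsplit : SplitsAt (closure V ∪ range b) δ :=
      .union_of_separatedNhds (normal_separation isClosed_closure hb_fin.isClosed hdisj)
        (hUsplit.mono hVU (min_le_right _ _)) (splitsAt_of_finite hb_fin hδ)
    exact hsplit.mono hCR le_rfl

theorem theorem4p1_general (hdim : smallInductiveDimension X ≤ 1) : ZeroCR X :=
  zeroCR_of_dense_splitsAt fun _ hδ =>
    dense_setOf_splitsAt_chainRecurrentSet (smallInductiveDimension_le_iff.1 hdim) hδ

end Density

theorem theorem4p1 {X : Type*} [MetricSpace X] (hcurve : IsCurve X)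
    (hlc : LocallyConnectedSpace X) : ZeroCR X := by
  obtain ⟨_, _, hdim⟩ := hcurve
  exact theorem4p1_general hdim.le
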